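/- Let $M$ be a smooth manifold, let $\mathbb{K}$ be $\mathbb{C}$ or $\mathbb{R}$, let $C^\infty(M)$ be the algebra of smooth $\mathbb{K}$-valued functions on $M$, and let $\Gamma(TM)$ be the Lie algebra of its derivations (the smooth vector fields, complexified if $\mathbb{K}=\mathbb{C}$). A Lie algebroid $A$ over $M$ is a finitely generated projective $C^\infty(M)$-module with a $\mathbb{K}$-Lie bracket and a $C^\infty(M)$-linear Lie morphism $\rho\colon A\to\Gamma(TM)$ (the anchor) such that $[a,fb]=f[a,b]+(\rho(a)\cdot f)\,b$ for all $a,b\in A$ and $f\in C^\infty(M)$. It is transitive if $\rho$ is surjective. Let $A$ be a transitive Lie algebroid with kernel $L=\ker\rho$; write $\mathcal{L}$ for the vector bundle with $L=\Gamma(\mathcal{L})$, and $A_U$, $L_U$ for the sections over an open set $U$ of the vector bundles of $A$ and $L$. Let $\Omega^\bullet(A,L)=\bigoplus_q\Omega^q(A,L)$, where $\Omega^q(A,L)$ is the space of alternating $C^\infty(M)$-multilinear maps $A^q\to L$. Let $\mathfrak{g}$ be a finite dimensional Lie algebra over $\mathbb{K}$. Let $TLA(U,\mathfrak{g})=\Gamma(TU)\oplus\Gamma(U\times\mathfrak{g})$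 be the trivial Lie algebroid, and let $\Omega^\bullet_{TLA}(U,\mathfrak{g})=\bigoplus_q\Omega^q_{TLA}(U,\mathfrak{g})$, where $\Omega^q_{TLA}(U,\mathfrak{g})$ is the space of alternating $C^\infty(U)$-multilinear maps $TLA(U,\mathfrak{g})^q\to\Gamma(U\times\mathfrak{g})$. A local trivialization of $A$ is a triple $(U,\Psi,\nabla^0)$ consisting of an open set $U\subseteq M$, an isomorphism $\Psi\colon U\times\mathfrak{g}\to\mathcal{L}|_U$ of bundles in Lie algebras, and a $C^\infty(U)$-linear Lie morphism $\nabla^0\colon\Gamma(TU)\to A_U$ with $\rho\circ\nabla^0=\mathrm{id}$ and $[\nabla^0_X,\Psi(\gamma)]=\Psi(X\cdot\gamma)$ for all $X\in\Gamma(TU)$ and $\gamma\in\Gamma(U\times\mathfrak{g})$. It defines an isomorphism $S\colon TLA(U,\mathfrak{g})\to A_U$, $S(X\oplus\gamma)=\nabla^0_X+\Psi(\gamma)$. The trivialization over $U$ of a form $\omega\in\Omega^\bullet(A,L)$ is $\Psi^{-1}\circ\omega\circ S\in\Omega^\bullet_{TLA}(U,\mathfrak{g})$. Let $(U_i,\Psi_i,\nabla^{0,i})_{i\in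 I}$ be a Lie algebroid atlas of $A$, that is, a family of local trivializations with $\bigcup_iU_i=M$. For $U_{ij}=U_i\cap U_j\neq\emptyset$ put $\alpha^i_j=\Psi_i^{-1}\circ\Psi_j$, $s_i^j=S_j^{-1}\circ S_i$ (over $U_{ij}$) and $\widehat\alpha{}^{\,i}_j(\omega)=\alpha^i_j\circ\omega\circ s_i^j$ for $\omega\in\Omega^\bullet_{TLA}(U_{ij},\mathfrak{g})$. Let $(\omega^i_{\mathrm{loc}})_{i\in I}$ be a family of local forms, $\omega^i_{\mathrm{loc}}\in\Omega^\bullet_{TLA}(U_i,\mathfrak{g})$. Then there is a global form $\omega\in\Omega^\bullet(A,L)$ with $$\omega^i_{\mathrm{loc}}=\Psi_i^{-1}\circ\omega\circ S_i\quad\text{for all } i\in I$$ if and only if $$\widehat\alpha{}^{\,i}_j\bigl(\omega^j_{\mathrm{loc}}|_{U_{ij}}\bigr)=\omega^i_{\mathrm{loc}}|_{U_{ij}}\quad\text{for all } i,j\in I \text{ with } U_{ij}\neq\emptyset.$$ -/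

import Mathlib

open scoped Manifold ContDiff Topology
open TopologicalSpace (Opens)

noncomputable section

namespace TransitiveLieAlgebroid

section Functions

variable (𝕜 : Type*) [RCLike 𝕜] {E : Type*} [NormedAddCommGroup E] [NormedSpace ℝ E]
  {H : Type*} [TopologicalSpace H] (I : ModelWithCorners ℝ E H)
  (M : Type*) [TopologicalSpace M] [ChartedSpace H M]

/-- The smooth `𝕜`-valued functions on the real manifold `M`, as a subalgebra of all functions. -/
def smoothSubalgebra : Subalgebra 𝕜 (M → 𝕜) where
  carrier := {f | ContMDiff I 𝓘(ℝ, 𝕜) ∞ f}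
  mul_mem' {f g} hf hg :=
    ContDiff.comp_contMDiff (g := fun p : 𝕜 × 𝕜 => p.1 * p.2) (f := fun x => (f x, g x))
      contDiff_mul (ContMDiff.prodMk_space hf hg)
  add_mem' {f g} hf hg :=
    ContDiff.comp_contMDiff (g := fun p : 𝕜 × 𝕜 => p.1 + p.2) (f := fun x => (f x, g x))
      contDiff_add (ContMDiff.prodMk_space hf hg)
  algebraMap_mem' _ := contMDiff_const

/-- The algebra `C^∞(M)` of smooth `𝕜`-valued functions on `M`. -/
def SmoothFun : Type _ := smoothSubalgebra 𝕜 I M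

instance : CommRing (SmoothFun 𝕜 I M) := inferInstanceAs (CommRing (smoothSubalgebra 𝕜 I M))

instance : Algebra 𝕜 (SmoothFun 𝕜 I M) := inferInstanceAs (Algebra 𝕜 (smoothSubalgebra 𝕜 I M))

/-- The smooth vector fields on `M`, acting on smooth `𝕜`-valued functions: the derivations of
`C^∞(M)`. For `𝕜 = ℂ` these are the sections of the complexified tangent bundle. -/
abbrev VectorField : Type _ :=
  Derivation 𝕜 (SmoothFun 𝕜 I M) (SmoothFun 𝕜 I M)

variable {M}

/-- Evaluation of smooth functions at `x`. -/
def evalAt (x : M) : SmoothFun 𝕜 I M →ₐ[𝕜] 𝕜 :=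
  (Pi.evalAlgHom 𝕜 (fun _ : M => 𝕜) x).comp (smoothSubalgebra 𝕜 I M).val

/-- The ideal of the smooth functions that vanish at `x`. -/
def vanishingIdeal (x : M) : Ideal (SmoothFun 𝕜 I M) := RingHom.ker (evalAt 𝕜 I x)

variable (P : Type*) [AddCommGroup P] [Module (SmoothFun 𝕜 I M) P]

/-- The fibre at `x` of the vector bundle whose module of sections is `P`. -/
abbrev Fibre (x : M) : Type _ :=
  P ⧸ (vanishingIdeal 𝕜 I x • ⊤ : Submodule (SmoothFun 𝕜 I M) P)

variable {P}

/-- The value at `x` of a section `p`. -/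
def value (p : P) (x : M) : Fibre 𝕜 I P x := Submodule.Quotient.mk p

/-- `s` coincides with the global section `p` near the point `x`. -/
def AgreesNear {U : Opens M} (s : ∀ x : U, Fibre 𝕜 I P (x : M)) (p : P) (x : M) : Prop :=
  ∀ᶠ y in 𝓝 x, ∀ hy : y ∈ U, s ⟨y, hy⟩ = value 𝕜 I p y

/-- `s` is a smooth section over `U` of the vector bundle whose module of global sections is `P`:
near each point of `U` it coincides with a global section. -/
def IsSection {U : Opens M} (s : ∀ x : U, Fibre 𝕜 I P (x : M)) : Prop :=
  ∀ x ∈ U, ∃ p : P, AgreesNear 𝕜 I s p x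

/-- `γ` is a smooth section over `U` of the trivial bundle with fibre the finite dimensional
space `𝔤`: its coordinates are smooth. -/
def IsSmoothMap {𝔤 : Type*} [AddCommGroup 𝔤] [Module 𝕜 𝔤] {U : Opens M} (γ : U → 𝔤) : Prop :=
  ∀ φ : Module.Dual 𝕜 𝔤, ContMDiff I 𝓘(ℝ, 𝕜) ∞ fun x : U => φ (γ x)

/-- `δ = X · γ`, the derivative of the smooth map `γ : U → 𝔤` along the vector field `X` over `U`,
computed coordinatewise through germs. -/
def IsDerivativeAlong {𝔤 : Type*} [AddCommGroup 𝔤] [Module 𝕜 𝔤] {U : Opens M}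
    (X : ∀ x : U, Fibre 𝕜 I (VectorField 𝕜 I M) (x : M)) (γ δ : U → 𝔤) : Prop :=
  ∀ (φ : Module.Dual 𝕜 𝔤) (x : U) (D : VectorField 𝕜 I M) (f : SmoothFun 𝕜 I M),
    AgreesNear 𝕜 I X D x → (∀ᶠ y in 𝓝 (x : M), ∀ hy : y ∈ U, φ (γ ⟨y, hy⟩) = f.1 y) →
      φ (δ x) = (D f).1 x

end Functions

section Extension

variable {𝕜 : Type*} [RCLike 𝕜] {E : Type*} [NormedAddCommGroup E] [NormedSpace ℝ E]
  [FiniteDimensional ℝ E] {H : Type*} [TopologicalSpace H] {I : ModelWithCorners ℝ E H}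
  {M : Type*} [TopologicalSpace M] [ChartedSpace H M] [IsManifold I ∞ M] [T2Space M]

theorem exists_smoothFun_agrees {V : Opens M} {f : V → 𝕜} (hf : ContMDiff I 𝓘(ℝ, 𝕜) ∞ f)
    (x : V) : ∃ F : SmoothFun 𝕜 I M, ∀ᶠ y in 𝓝 (x : M), ∀ hy : y ∈ V, f ⟨y, hy⟩ = F.1 y := by
  classical
  let f' : M → 𝕜 := fun y => if h : y ∈ V then f ⟨y, h⟩ else 0
  have hf' : ∀ y ∈ V, ContMDiffAt I 𝓘(ℝ, 𝕜) ∞ f' y := by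
    intro y hy
    have := (contMDiffAt_subtype_iff (I := I) (I' := 𝓘(ℝ, 𝕜)) (n := ∞) (U := V) (f := f')
      (x := ⟨y, hy⟩)).1
    apply this
    have h2 : (fun z : V => f' z) = f := by
      funext z
      simp [f']
    rw [h2]
    exact hf _
  obtain ⟨χ, -, hχ⟩ := (SmoothBumpFunction.nhds_basis_tsupport (I := I) (x : M)).mem_iff.1
    (V.isOpen.mem_nhds x.2)
  refine ⟨⟨fun y => χ y • f' y, ?_⟩, ?_⟩
  · apply contMDiff_of_tsupport
    intro y hy
    have hy' : y ∈ tsupport χ := tsupport_smul_subset_left (χ : M → ℝ) f' hy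
    exact ContMDiffAt.smul χ.contMDiffAt (hf' y (hχ hy'))
  · filter_upwards [χ.eventuallyEq_one] with y hy hyV
    simp only [Pi.one_apply] at hy
    simp [f', hyV, hy]

theorem isSmoothMap_of_forall_exists {𝔤 : Type*} [AddCommGroup 𝔤] [Module 𝕜 𝔤] {V U : Opens M}
    {γ : V → 𝔤}
    (h : ∀ x (_ : x ∈ V), ∃ η : U → 𝔤, IsSmoothMap 𝕜 I η ∧ x ∈ U ∧
      ∀ᶠ y in 𝓝 x, ∀ (hy : y ∈ V) (hU : y ∈ U), γ ⟨y, hy⟩ = η ⟨y, hU⟩) :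
    IsSmoothMap 𝕜 I γ := by
  classical
  intro φ x
  obtain ⟨η, hη, hxU, hx⟩ := h x x.2
  obtain ⟨F, hF⟩ := exists_smoothFun_agrees (hη φ) ⟨x, hxU⟩
  have hF' : ContMDiffAt I 𝓘(ℝ, 𝕜) ∞ (fun y : V => F.1 (y : M)) x :=
    (contMDiffAt_subtype_iff (I := I) (I' := 𝓘(ℝ, 𝕜)) (n := ∞) (U := V) (f := F.1)
      (x := x)).2 (F.2 _)
  refine hF'.congr_of_eventuallyEq ?_
  have h1 := (continuous_subtype_val.continuousAt (x := x)).eventually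
    ((hx.and hF).and (U.isOpen.mem_nhds hxU))
  filter_upwards [h1] with y hy
  obtain ⟨⟨h1, h2⟩, h3⟩ := hy
  rw [← h2 h3, ← h1 y.2 h3]

theorem exists_isSmoothMap_agrees {𝔤 : Type*} [AddCommGroup 𝔤] [Module 𝕜 𝔤]
    [FiniteDimensional 𝕜 𝔤] {V : Opens M} (U : Opens M) {γ : V → 𝔤} (hγ : IsSmoothMap 𝕜 I γ)
    (x : V) : ∃ η : U → 𝔤, IsSmoothMap 𝕜 I η ∧
      ∀ᶠ y in 𝓝 (x : M), ∀ (hy : y ∈ V) (hU : y ∈ U), γ ⟨y, hy⟩ = η ⟨y, hU⟩ := by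
  let b := Module.finBasis 𝕜 𝔤
  choose F hF using fun k => exists_smoothFun_agrees (hγ (b.coord k)) x
  refine ⟨fun y => ∑ k, (F k).1 (y : M) • b k, ?_, ?_⟩
  · intro φ
    let G : SmoothFun 𝕜 I M := ∑ k, φ (b k) • F k
    have hG : ContMDiff I 𝓘(ℝ, 𝕜) ∞ (G.1 : M → 𝕜) := G.2
    have : (fun y : U => φ (∑ k, (F k).1 (y : M) • b k)) = fun y : U => G.1 (y : M) := by
      funext y
      change _ = evalAt 𝕜 I (y : M) (∑ k, φ (b k) • F k)
      rw [map_sum, map_sum]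
      refine Finset.sum_congr rfl fun k _ => ?_
      rw [map_smul, map_smul, smul_eq_mul, smul_eq_mul, mul_comm]
      rfl
    rw [this]
    exact hG.comp contMDiff_subtype_val
  · filter_upwards [Filter.eventually_all.2 hF] with y hy hyV hyU
    rw [← b.sum_repr (γ ⟨y, hyV⟩)]
    exact Finset.sum_congr rfl fun k _ => by rw [← hy k hyV]; rfl

end Extension

section Bracket

variable (𝕜 : Type*) [RCLike 𝕜] {E : Type*} [NormedAddCommGroup E] [NormedSpace ℝ E]
  {H : Type*} [TopologicalSpace H] (I : ModelWithCorners ℝ E H)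
  {M : Type*} [TopologicalSpace M] [ChartedSpace H M]
  {P : Type*} [LieRing P] [Module (SmoothFun 𝕜 I M) P]

/-- `u = [s, t]` for sections `s`, `t` over `U`. The bracket of a Lie algebroid is a local
operation, so that it restricts to sections over `U`: the value at `x` of `[s, t]` is that of
`[a, b]` for global sections `a`, `b` that coincide near `x` with `s`, `t`. -/
def IsBracket {U : Opens M} (s t u : ∀ x : U, Fibre 𝕜 I P (x : M)) : Prop :=
  ∀ (x : U) (a b : P), AgreesNear 𝕜 I s a x → AgreesNear 𝕜 I t b x →
    u x = value 𝕜 I ⁅a, b⁆ (x : M)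

end Bracket

section Algebroid

variable (𝕜 : Type*) [RCLike 𝕜] {E : Type*} [NormedAddCommGroup E] [NormedSpace ℝ E]
  {H : Type*} [TopologicalSpace H] (I : ModelWithCorners ℝ E H)
  (M : Type*) [TopologicalSpace M] [ChartedSpace H M]
  (A : Type*) [LieRing A] [LieAlgebra 𝕜 A] [Module (SmoothFun 𝕜 I M) A]
  [LieRingModule A (SmoothFun 𝕜 I M)] [LieRinehartRing (SmoothFun 𝕜 I M) A]
  [LieRinehartAlgebra 𝕜 (SmoothFun 𝕜 I M) A]

/-- The anchor `ρ : A → Γ(TM)`. A Lie algebroid over `M` is, through the module `A` of its sections, a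
finitely generated projective `C^∞(M)`-module that is a Lie–Rinehart algebra over `C^∞(M)`: it has a
Lie bracket and a `C^∞(M)`-linear Lie morphism `ρ` to the vector fields with
`[a, f b] = f [a, b] + (ρ(a) · f) b`. -/
def anchor : A →ₗ[SmoothFun 𝕜 I M] VectorField 𝕜 I M where
  toFun a := LieRinehartAlgebra.anchor 𝕜 (SmoothFun 𝕜 I M) A a
  map_add' a b := map_add (LieRinehartAlgebra.anchor 𝕜 (SmoothFun 𝕜 I M) A).toLieHom a b
  map_smul' f a := (LieRinehartAlgebra.anchor 𝕜 (SmoothFun 𝕜 I M) A).map_smul_apply f a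

/-- A Lie algebroid is transitive if its anchor is surjective. -/
def IsTransitive : Prop := Function.Surjective (anchor 𝕜 I M A)

/-- The kernel `L` of `A`. -/
abbrev Kernel : Submodule (SmoothFun 𝕜 I M) A := LinearMap.ker (anchor 𝕜 I M A)

variable {M}

/-- The anchor on the fibres at `x`. -/
def anchorAt (x : M) : Fibre 𝕜 I A x →ₗ[𝕜] Fibre 𝕜 I (VectorField 𝕜 I M) x :=
  (Submodule.mapQ _ _ (anchor 𝕜 I M A) (by
    rw [← Submodule.map_le_iff_le_comap, Submodule.map_smul'']
    exact smul_mono_right _ le_top)).restrictScalars 𝕜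

/-- The fibre at `x` of the vector bundle of the kernel `L` of a transitive Lie algebroid. -/
abbrev KernelFibre (x : M) : Submodule 𝕜 (Fibre 𝕜 I A x) := LinearMap.ker (anchorAt 𝕜 I A x)

variable {A}

/-- The value at `x` of a section of `L`. -/
def kernelValue (l : Kernel 𝕜 I M A) (x : M) : KernelFibre 𝕜 I A x :=
  ⟨value 𝕜 I l.1 x, by
    have h : anchorAt 𝕜 I A x (value 𝕜 I l.1 x) = Submodule.Quotient.mk (anchor 𝕜 I M A l.1) := rfl
    rw [LinearMap.mem_ker, h, LinearMap.mem_ker.1 l.2, Submodule.Quotient.mk_zero]⟩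

variable (A) (M)

/-- The forms `Ω^q(A, L)` of degree `q` on `A` with values in the kernel `L`. -/
abbrev Form (q : ℕ) : Type _ := A [⋀^Fin q]→ₗ[SmoothFun 𝕜 I M] Kernel 𝕜 I M A

end Algebroid

section FormAt

set_option linter.unusedSectionVars false

variable {𝕜 : Type*} [RCLike 𝕜] {E : Type*} [NormedAddCommGroup E] [NormedSpace ℝ E]
  {H : Type*} [TopologicalSpace H] {I : ModelWithCorners ℝ E H}
  {M : Type*} [TopologicalSpace M] [ChartedSpace H M]
  {A : Type*} [LieRing A] [LieAlgebra 𝕜 A] [Module (SmoothFun 𝕜 I M) A]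
  [LieRingModule A (SmoothFun 𝕜 I M)] [LieRinehartRing (SmoothFun 𝕜 I M) A]
  [LieRinehartAlgebra 𝕜 (SmoothFun 𝕜 I M) A]

theorem value_form_congr {q : ℕ} (w : Form 𝕜 I M A q) (x : M) (a b : Fin q → A)
    (h : ∀ k, value 𝕜 I (a k) x = value 𝕜 I (b k) x) :
    kernelValue 𝕜 I (w a) x = kernelValue 𝕜 I (w b) x := by
  classical
  have key : ∀ (c : Fin q → A) (k : Fin q) (u v : A), value 𝕜 I u x = value 𝕜 I v x →
      value 𝕜 I (w (Function.update c k u) : A) x = value 𝕜 I (w (Function.update c k v) : A) x := by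
    intro c k u v huv
    have hmem := (Submodule.Quotient.eq _).1 huv
    refine (Submodule.Quotient.eq _).2 ?_
    have hlin := Submodule.mem_map_of_mem (f := (Kernel 𝕜 I M A).subtype.comp
      (w.toMultilinearMap.toLinearMap c k)) hmem
    rw [Submodule.map_smul''] at hlin
    have h2 := smul_mono_right (vanishingIdeal 𝕜 I x)
      (le_top (a := Submodule.map ((Kernel 𝕜 I M A).subtype.comp
        (w.toMultilinearMap.toLinearMap c k)) ⊤)) hlin
    simpa using h2
  have all : ∀ s : Finset (Fin q),
      value 𝕜 I (w (s.piecewise a b) : A) x = value 𝕜 I (w b : A) x := by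
    intro s
    induction s using Finset.induction_on with
    | empty => simp
    | insert k s hk ih =>
      rw [← ih, Finset.piecewise_insert, key _ k (a k) (b k) (h k)]
      congr 3
      rw [Function.update_eq_self_iff]
      simp [hk]
  apply Subtype.ext
  have h2 := all Finset.univ
  rw [Finset.piecewise_univ] at h2
  exact h2

/-- Auxiliary function for `formAt`. -/
def formAtFun {q : ℕ} (w : Form 𝕜 I M A q) (x : M) (v : Fin q → Fibre 𝕜 I A x) :
    KernelFibre 𝕜 I A x :=
  kernelValue 𝕜 I (w fun k => (v k).out) x

theorem formAtFun_value {q : ℕ} (w : Form 𝕜 I M A q) (x : M) (a : Fin q → A) :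
    formAtFun w x (fun k => value 𝕜 I (a k) x) = kernelValue 𝕜 I (w a) x :=
  value_form_congr w x _ _ fun _ => Quotient.out_eq _

theorem exists_value_eq {q : ℕ} {x : M} (v : Fin q → Fibre 𝕜 I A x) :
    ∃ a : Fin q → A, v = fun k => value 𝕜 I (a k) x :=
  ⟨fun k => (v k).out, funext fun _ => (Quotient.out_eq _).symm⟩

theorem update_value {q : ℕ} [DecidableEq (Fin q)] {x : M} (a : Fin q → A) (k : Fin q) (c : A) :
    Function.update (fun l => value 𝕜 I (a l) x) k (value 𝕜 I c x)
      = fun l => value 𝕜 I (Function.update a k c l) x :=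
  (Function.comp_update (fun c => value 𝕜 I c x) a k c).symm

/-- The value at `x` of a form on `A` with values in `L`: the alternating map on the fibre that is
given by `(a₁(x), …, a_q(x)) ↦ w(a₁, …, a_q)(x)`. -/
def formAt {q : ℕ} (w : Form 𝕜 I M A q) (x : M) :
    Fibre 𝕜 I A x [⋀^Fin q]→ₗ[𝕜] KernelFibre 𝕜 I A x where
  toFun := formAtFun w x
  map_update_add' v k a b := by
    obtain ⟨v, rfl⟩ := exists_value_eq v
    induction a using Submodule.Quotient.induction_on with | _ a
    induction b using Submodule.Quotient.induction_on with | _ b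
    have h := congrArg (fun l => kernelValue 𝕜 I l x) (w.map_update_add v k a b)
    change formAtFun w x (Function.update _ k (value 𝕜 I (a + b) x))
      = formAtFun w x (Function.update _ k (value 𝕜 I a x))
        + formAtFun w x (Function.update _ k (value 𝕜 I b x))
    rw [update_value, update_value, update_value, formAtFun_value, formAtFun_value,
      formAtFun_value]
    exact h
  map_update_smul' v k c a := by
    obtain ⟨v, rfl⟩ := exists_value_eq v
    induction a using Submodule.Quotient.induction_on with | _ a
    have h := congrArg (fun l => kernelValue 𝕜 I l x)
      (w.map_update_smul v k (algebraMap 𝕜 (SmoothFun 𝕜 I M) c) a)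
    rw [algebraMap_smul, algebraMap_smul] at h
    change formAtFun w x (Function.update _ k (value 𝕜 I (c • a) x))
      = c • formAtFun w x (Function.update _ k (value 𝕜 I a x))
    rw [update_value, update_value, formAtFun_value, formAtFun_value]
    exact h
  map_eq_zero_of_eq' v i j h hij := by
    have := w.map_eq_zero_of_eq (fun k => (v k).out) (i := i) (j := j) (by simp [h]) hij
    rw [formAtFun, this]
    rfl

end FormAt

section Trivialization

variable (𝕜 : Type*) [RCLike 𝕜] {E : Type*} [NormedAddCommGroup E] [NormedSpace ℝ E]
  {H : Type*} [TopologicalSpace H] (I : ModelWithCorners ℝ E H)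
  (M : Type*) [TopologicalSpace M] [ChartedSpace H M]
  (A : Type*) [LieRing A] [LieAlgebra 𝕜 A] [Module (SmoothFun 𝕜 I M) A]
  [LieRingModule A (SmoothFun 𝕜 I M)] [LieRinehartRing (SmoothFun 𝕜 I M) A]
  [LieRinehartAlgebra 𝕜 (SmoothFun 𝕜 I M) A]
  (𝔤 : Type*) [LieRing 𝔤] [LieAlgebra 𝕜 𝔤]

/-- A local trivialization `(U, Ψ, ∇⁰)` of a transitive Lie algebroid `A`. The `C^∞(U)`-linear maps
`Ψ` and `∇⁰` between spaces of sections are given on the fibres. -/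
structure LocalTrivialization where
  /-- The domain. -/
  U : Opens M
  /-- The trivialization `Ψ : U × 𝔤 → L_U` of the bundle in Lie algebras `L`. -/
  Ψ : ∀ x : U, 𝔤 ≃ₗ[𝕜] KernelFibre 𝕜 I A (x : M)
  isSection_Ψ : ∀ γ : U → 𝔤, IsSmoothMap 𝕜 I γ →
    IsSection 𝕜 I fun x : U => (Ψ x (γ x) : Fibre 𝕜 I A (x : M))
  isSmoothMap_Ψ_symm : ∀ l : ∀ x : U, KernelFibre 𝕜 I A (x : M),
    (IsSection 𝕜 I fun x : U => (l x : Fibre 𝕜 I A (x : M))) →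
      IsSmoothMap 𝕜 I fun x : U => (Ψ x).symm (l x)
  /-- `[Ψ(γ), Ψ(η)] = Ψ([γ, η])`. -/
  Ψ_lie : ∀ γ η : U → 𝔤, IsSmoothMap 𝕜 I γ → IsSmoothMap 𝕜 I η →
    IsBracket 𝕜 I (fun x : U => (Ψ x (γ x) : Fibre 𝕜 I A (x : M)))
      (fun x : U => (Ψ x (η x) : Fibre 𝕜 I A (x : M)))
      (fun x : U => (Ψ x ⁅γ x, η x⁆ : Fibre 𝕜 I A (x : M)))
  /-- The flat local connection `∇⁰ : Γ(TU) → A_U`. -/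
  nabla : ∀ x : U, Fibre 𝕜 I (VectorField 𝕜 I M) (x : M) →ₗ[𝕜] Fibre 𝕜 I A (x : M)
  isSection_nabla : ∀ X : ∀ x : U, Fibre 𝕜 I (VectorField 𝕜 I M) (x : M), IsSection 𝕜 I X →
    IsSection 𝕜 I fun x : U => nabla x (X x)
  /-- `ρ ∘ ∇⁰ = id`. -/
  anchor_nabla : ∀ (x : U) (v : Fibre 𝕜 I (VectorField 𝕜 I M) (x : M)),
    anchorAt 𝕜 I A (x : M) (nabla x v) = v
  /-- `[∇⁰_X, ∇⁰_Y] = ∇⁰_[X, Y]`. -/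
  nabla_lie : ∀ X Y Z : ∀ x : U, Fibre 𝕜 I (VectorField 𝕜 I M) (x : M),
    IsSection 𝕜 I X → IsSection 𝕜 I Y → IsBracket 𝕜 I X Y Z →
      IsBracket 𝕜 I (fun x : U => nabla x (X x)) (fun x : U => nabla x (Y x))
        (fun x : U => nabla x (Z x))
  /-- `[∇⁰_X, Ψ(γ)] = Ψ(X · γ)`. -/
  nabla_lie_Ψ : ∀ (X : ∀ x : U, Fibre 𝕜 I (VectorField 𝕜 I M) (x : M)) (γ δ : U → 𝔤),
    IsSection 𝕜 I X → IsSmoothMap 𝕜 I γ → IsDerivativeAlong 𝕜 I X γ δ →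
      IsBracket 𝕜 I (fun x : U => nabla x (X x))
        (fun x : U => (Ψ x (γ x) : Fibre 𝕜 I A (x : M)))
        (fun x : U => (Ψ x (δ x) : Fibre 𝕜 I A (x : M)))

/-- A Lie algebroid atlas: a family of local trivializations whose domains cover `M`. -/
structure Atlas (ι : Type*) where
  triv : ι → LocalTrivialization 𝕜 I M A 𝔤
  cover : ∀ x : M, ∃ i, x ∈ (triv i).U

variable {M}

/-- The fibre at `x` of the bundle `TM ⊕ (M × 𝔤)` of the trivial Lie algebroid. -/
abbrev TLAFibre (x : M) : Type _ := Fibre 𝕜 I (VectorField 𝕜 I M) x × 𝔤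

variable {𝔤}

/-- `v = X ⊕ γ` is an element of `TLA(U, 𝔤)`. -/
def IsTLASection {U : Opens M} (v : ∀ x : U, TLAFibre 𝕜 I 𝔤 (x : M)) : Prop :=
  (IsSection 𝕜 I fun x : U => (v x).1) ∧ IsSmoothMap 𝕜 I fun x : U => (v x).2

variable (𝔤)

/-- The local forms `Ω^q_TLA(U, 𝔤)`, i.e. the `𝔤`-valued forms of degree `q` on the trivial Lie
algebroid `TLA(U, 𝔤)`: fields of alternating maps on the fibres that send smooth sections to smooth
maps. -/
def LocalForm (U : Opens M) (q : ℕ) :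
    Submodule 𝕜 (∀ x : U, TLAFibre 𝕜 I 𝔤 (x : M) [⋀^Fin q]→ₗ[𝕜] 𝔤) where
  carrier := {w | ∀ v : Fin q → ∀ x : U, TLAFibre 𝕜 I 𝔤 (x : M),
    (∀ k, IsTLASection 𝕜 I (v k)) → IsSmoothMap 𝕜 I fun x => w x fun k => v k x}
  add_mem' {w w'} hw hw' v hv φ := by
    have := ContDiff.comp_contMDiff (g := fun p : 𝕜 × 𝕜 => p.1 + p.2) contDiff_add
      (ContMDiff.prodMk_space (hw v hv φ) (hw' v hv φ))
    refine this.congr fun x => ?_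
    simp
  zero_mem' v _ φ := by
    refine (contMDiff_const (c := (0 : 𝕜))).congr fun x => ?_
    simp
  smul_mem' c w hw v hv φ := by
    have := hw v hv (c • φ)
    refine this.congr fun x => ?_
    simp

end Trivialization

section Localization

variable {𝕜 : Type*} [RCLike 𝕜] {E : Type*} [NormedAddCommGroup E] [NormedSpace ℝ E]
  {H : Type*} [TopologicalSpace H] {I : ModelWithCorners ℝ E H}
  {M : Type*} [TopologicalSpace M] [ChartedSpace H M]
  {A : Type*} [LieRing A] [LieAlgebra 𝕜 A] [Module (SmoothFun 𝕜 I M) A]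
  [LieRingModule A (SmoothFun 𝕜 I M)] [LieRinehartRing (SmoothFun 𝕜 I M) A]
  [LieRinehartAlgebra 𝕜 (SmoothFun 𝕜 I M) A]
  {𝔤 : Type*} [LieRing 𝔤] [LieAlgebra 𝕜 𝔤]

namespace LocalTrivialization

variable (T : LocalTrivialization 𝕜 I M A 𝔤)

/-- The isomorphism `S : TLA(U, 𝔤) → A_U`, `S(X ⊕ γ) = ∇⁰_X + Ψ(γ)`, on the fibres. -/
def S (x : T.U) : TLAFibre 𝕜 I 𝔤 (x : M) ≃ₗ[𝕜] Fibre 𝕜 I A (x : M) where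
  toFun v := T.nabla x v.1 + (T.Ψ x v.2 : Fibre 𝕜 I A (x : M))
  map_add' v v' := by
    simp only [Prod.fst_add, Prod.snd_add, map_add, Submodule.coe_add]
    abel
  map_smul' c v := by simp
  invFun a := (anchorAt 𝕜 I A (x : M) a,
    (T.Ψ x).symm ⟨a - T.nabla x (anchorAt 𝕜 I A (x : M) a), by
      rw [LinearMap.mem_ker, map_sub, T.anchor_nabla, sub_self]⟩)
  left_inv v := by
    have h : anchorAt 𝕜 I A (x : M) (T.Ψ x v.2 : Fibre 𝕜 I A (x : M)) = 0 :=
      LinearMap.mem_ker.1 (T.Ψ x v.2).2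
    refine Prod.ext ?_ ?_
    · simp [h, T.anchor_nabla]
    · simp [h, T.anchor_nabla]
  right_inv a := by simp

end LocalTrivialization

theorem isSection_congr {P : Type*} [AddCommGroup P] [Module (SmoothFun 𝕜 I M) P]
    {V U : Opens M} {s : ∀ x : V, Fibre 𝕜 I P (x : M)}
    (h : ∀ x (_ : x ∈ V), ∃ t : ∀ x : U, Fibre 𝕜 I P (x : M), IsSection 𝕜 I t ∧ x ∈ U ∧
      ∀ᶠ y in 𝓝 x, ∀ (hy : y ∈ V) (hU : y ∈ U), s ⟨y, hy⟩ = t ⟨y, hU⟩) :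
    IsSection 𝕜 I s := by
  intro x hx
  obtain ⟨t, ht, hxU, hst⟩ := h x hx
  obtain ⟨p, hp⟩ := ht x hxU
  refine ⟨p, ?_⟩
  filter_upwards [hp, hst, U.isOpen.mem_nhds hxU] with y h1 h2 h3 hy
  rw [h2 hy h3, h1 h3]

theorem isSection_value {P : Type*} [AddCommGroup P] [Module (SmoothFun 𝕜 I M) P] (U : Opens M)
    (p : P) : IsSection 𝕜 I fun x : U => value 𝕜 I p (x : M) :=
  fun _ _ => ⟨p, Filter.Eventually.of_forall fun _ _ => rfl⟩

theorem IsSection.add {P : Type*} [AddCommGroup P] [Module (SmoothFun 𝕜 I M) P] {U : Opens M}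
    {s t : ∀ x : U, Fibre 𝕜 I P (x : M)} (hs : IsSection 𝕜 I s) (ht : IsSection 𝕜 I t) :
    IsSection 𝕜 I fun x => s x + t x := by
  intro x hx
  obtain ⟨p, hp⟩ := hs x hx
  obtain ⟨r, hr⟩ := ht x hx
  refine ⟨p + r, ?_⟩
  filter_upwards [hp, hr] with y h1 h2 hy
  rw [h1 hy, h2 hy]
  rfl

theorem IsSection.sub {P : Type*} [AddCommGroup P] [Module (SmoothFun 𝕜 I M) P] {U : Opens M}
    {s t : ∀ x : U, Fibre 𝕜 I P (x : M)} (hs : IsSection 𝕜 I s) (ht : IsSection 𝕜 I t) :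
    IsSection 𝕜 I fun x => s x - t x := by
  intro x hx
  obtain ⟨p, hp⟩ := hs x hx
  obtain ⟨r, hr⟩ := ht x hx
  refine ⟨p - r, ?_⟩
  filter_upwards [hp, hr] with y h1 h2 hy
  rw [h1 hy, h2 hy]
  rfl

theorem IsSection.anchorAt {U : Opens M} {s : ∀ x : U, Fibre 𝕜 I A (x : M)}
    (hs : IsSection 𝕜 I s) : IsSection 𝕜 I fun x : U => anchorAt 𝕜 I A (x : M) (s x) := by
  intro x hx
  obtain ⟨p, hp⟩ := hs x hx
  refine ⟨anchor 𝕜 I M A p, ?_⟩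
  filter_upwards [hp] with y h1 hy
  rw [h1 hy]
  rfl

variable [FiniteDimensional ℝ E] [IsManifold I ∞ M] [T2Space M]

namespace LocalTrivialization

variable (T : LocalTrivialization 𝕜 I M A 𝔤)

theorem isSection_S [FiniteDimensional 𝕜 𝔤] {V : Opens M} (hV : V ≤ T.U)
    {v : ∀ x : V, TLAFibre 𝕜 I 𝔤 (x : M)} (hv : IsTLASection 𝕜 I v) :
    IsSection 𝕜 I fun x : V => T.S ⟨x, hV x.2⟩ (v x) := by
  refine isSection_congr (U := T.U) fun x hx => ?_
  obtain ⟨D, hD⟩ := hv.1 x hx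
  obtain ⟨η, hη, hγη⟩ := exists_isSmoothMap_agrees T.U hv.2 ⟨x, hx⟩
  refine ⟨_, (T.isSection_nabla _ (isSection_value T.U D)).add (T.isSection_Ψ η hη), hV hx, ?_⟩
  filter_upwards [hD, hγη] with y h1 h2 hy hU
  rw [← h1 hy, ← h2 hy hU]
  rfl

theorem isTLASection_S_symm {V : Opens M} (hV : V ≤ T.U)
    {s : ∀ x : V, Fibre 𝕜 I A (x : M)} (hs : IsSection 𝕜 I s) :
    IsTLASection 𝕜 I fun x : V => (T.S ⟨x, hV x.2⟩).symm (s x) := by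
  refine ⟨hs.anchorAt, isSmoothMap_of_forall_exists (U := T.U) fun x hx => ?_⟩
  obtain ⟨a, ha⟩ := hs x hx
  have hsec := isSection_value (𝕜 := 𝕜) (I := I) T.U a
  refine ⟨fun y => ((T.S y).symm (value 𝕜 I a (y : M))).2,
    T.isSmoothMap_Ψ_symm _ (hsec.sub (T.isSection_nabla _ hsec.anchorAt)), hV hx, ?_⟩
  filter_upwards [ha] with y h1 hy hU
  rw [h1 hy]

theorem isSmoothMap_Ψ_symm_of_le {V : Opens M} (hV : V ≤ T.U)
    {l : ∀ x : V, KernelFibre 𝕜 I A (x : M)}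
    (hl : IsSection 𝕜 I fun x : V => (l x : Fibre 𝕜 I A (x : M))) :
    IsSmoothMap 𝕜 I fun x : V => (T.Ψ ⟨x, hV x.2⟩).symm (l x) := by
  have h := (T.isTLASection_S_symm hV hl).2
  have heq : (fun x : V => ((T.S ⟨x, hV x.2⟩).symm (l x : Fibre 𝕜 I A (x : M))).2)
      = fun x : V => (T.Ψ ⟨x, hV x.2⟩).symm (l x) := by
    funext x
    have h0 : (T.S ⟨x, hV x.2⟩).symm (l x : Fibre 𝕜 I A (x : M))
        = (0, (T.Ψ ⟨x, hV x.2⟩).symm (l x)) := by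
      rw [LinearEquiv.symm_apply_eq]
      simp [S]
    rw [h0]
  rwa [heq] at h

theorem isSection_Ψ_of_le [FiniteDimensional 𝕜 𝔤] {V : Opens M} (hV : V ≤ T.U) {γ : V → 𝔤}
    (hγ : IsSmoothMap 𝕜 I γ) :
    IsSection 𝕜 I fun x : V => (T.Ψ ⟨x, hV x.2⟩ (γ x) : Fibre 𝕜 I A (x : M)) := by
  refine isSection_congr (U := T.U) fun x hx => ?_
  obtain ⟨η, hη, hγη⟩ := exists_isSmoothMap_agrees T.U hγ ⟨x, hx⟩
  refine ⟨_, T.isSection_Ψ η hη, hV hx, ?_⟩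
  filter_upwards [hγη] with y h2 hy hU
  rw [← h2 hy hU]

/-- The trivialization `w_loc = Ψ⁻¹ ∘ w ∘ S` over `U` of a form `w` in `Ω^q(A, L)`. -/
def loc [FiniteDimensional 𝕜 𝔤] {q : ℕ} (w : Form 𝕜 I M A q) : LocalForm 𝕜 I 𝔤 T.U q :=
  ⟨fun x => (T.Ψ x).symm.toLinearMap.compAlternatingMap
    ((formAt w (x : M)).compLinearMap (T.S x).toLinearMap), by
    intro v hv
    refine T.isSmoothMap_Ψ_symm (fun x => formAt w (x : M) fun k => T.S x (v k x)) ?_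
    intro x hx
    choose a ha using fun k => T.isSection_S le_rfl (hv k) x hx
    refine ⟨(w a : A), ?_⟩
    filter_upwards [Filter.eventually_all.2 ha] with y hy hyU
    have h : (fun k => T.S ⟨y, hyU⟩ (v k ⟨y, hyU⟩)) = fun k => value 𝕜 I (a k) y :=
      funext fun k => hy k hyU
    change ((formAtFun w y fun k => T.S ⟨y, hyU⟩ (v k ⟨y, hyU⟩) : KernelFibre 𝕜 I A y) :
      Fibre 𝕜 I A y) = _
    rw [h, formAtFun_value]
    rfl⟩

variable (T' : LocalTrivialization 𝕜 I M A 𝔤)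

/-- The change of trivialization `α^i_j = Ψ_i⁻¹ ∘ Ψ_j` at a point of `U_i ∩ U_j`, for `i = T` and
`j = T'`. -/
def alpha (x : (T.U ⊓ T'.U : Opens M)) : 𝔤 ≃ₗ[𝕜] 𝔤 :=
  (T'.Ψ ⟨x, x.2.2⟩).trans (T.Ψ ⟨x, x.2.1⟩).symm

/-- The isomorphism `s_i^j = S_j⁻¹ ∘ S_i` of `TLA(U_i ∩ U_j, 𝔤)` on the fibres, for `i = T` and
`j = T'`. -/
def transition (x : (T.U ⊓ T'.U : Opens M)) :
    TLAFibre 𝕜 I 𝔤 (x : M) ≃ₗ[𝕜] TLAFibre 𝕜 I 𝔤 (x : M) :=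
  (T.S ⟨x, x.2.1⟩).trans (T'.S ⟨x, x.2.2⟩).symm

/-- The map `α̂_j^i(w) = α^i_j ∘ w ∘ s_i^j` on `Ω^q_TLA(U_i ∩ U_j, 𝔤)`, for `i = T` and
`j = T'`. -/
def alphaHat [FiniteDimensional 𝕜 𝔤] {q : ℕ} (w : LocalForm 𝕜 I 𝔤 (T.U ⊓ T'.U) q) :
    LocalForm 𝕜 I 𝔤 (T.U ⊓ T'.U) q :=
  ⟨fun x => (alpha T T' x).toLinearMap.compAlternatingMap
    ((w.1 x).compLinearMap (transition T T' x).toLinearMap), by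
    intro v hv
    have h := w.2 (fun k x => transition T T' x (v k x)) fun k =>
      T'.isTLASection_S_symm inf_le_right (T.isSection_S inf_le_left (hv k))
    exact T.isSmoothMap_Ψ_symm_of_le inf_le_left (T'.isSection_Ψ_of_le inf_le_right h)⟩

end LocalTrivialization

/-- The restriction of a local form to a smaller open set. -/
def LocalForm.restrict [FiniteDimensional 𝕜 𝔤] {U V : Opens M} (hV : V ≤ U) {q : ℕ}
    (w : LocalForm 𝕜 I 𝔤 U q) : LocalForm 𝕜 I 𝔤 V q :=
  ⟨fun x => w.1 ⟨x, hV x.2⟩, by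
    intro v hv
    refine isSmoothMap_of_forall_exists (U := U) fun x hx => ?_
    choose D hD using fun k => (hv k).1 x hx
    choose η hη hvη using fun k => exists_isSmoothMap_agrees U (hv k).2 ⟨x, hx⟩
    refine ⟨_, w.2 (fun k y => (value 𝕜 I (D k) (y : M), η k y)) fun k =>
      ⟨isSection_value U (D k), hη k⟩, hV hx, ?_⟩
    filter_upwards [Filter.eventually_all.2 hD, Filter.eventually_all.2 hvη] with y h1 h2 hy hU
    congr 1
    funext k
    exact Prod.ext (h1 k hy) (h2 k hy hU)⟩

end Localization

end TransitiveLieAlgebroid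

end

open TransitiveLieAlgebroid

namespace TransitiveLieAlgebroid

section Sections

variable {𝕜 : Type*} [RCLike 𝕜] {E : Type*} [NormedAddCommGroup E] [NormedSpace ℝ E]
  {H : Type*} [TopologicalSpace H] {I : ModelWithCorners ℝ E H}
  {M : Type*} [TopologicalSpace M] [ChartedSpace H M]
  {P : Type*} [AddCommGroup P] [Module (SmoothFun 𝕜 I M) P]

theorem SmoothFun.ext {f g : SmoothFun 𝕜 I M} (h : ∀ x, evalAt 𝕜 I x f = evalAt 𝕜 I x g) :
    f = g :=
  Subtype.ext (funext h)

theorem exists_eq_value {x : M} (v : Fibre 𝕜 I P x) : ∃ p : P, v = value 𝕜 I p x :=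
  ⟨v.out, (Quotient.out_eq _).symm⟩

theorem evalAt_map_congr (φ : P →ₗ[SmoothFun 𝕜 I M] SmoothFun 𝕜 I M) {x : M} {p p' : P}
    (h : value 𝕜 I p x = value 𝕜 I p' x) : evalAt 𝕜 I x (φ p) = evalAt 𝕜 I x (φ p') := by
  have hmem := Submodule.mem_map_of_mem (f := φ) ((Submodule.Quotient.eq _).1 h)
  rw [Submodule.map_smul''] at hmem
  have h2 : φ (p - p') ∈ vanishingIdeal 𝕜 I x :=
    Submodule.smul_le.2 (fun f hf g _ => Ideal.mul_mem_right g _ hf) hmem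
  have h3 : evalAt 𝕜 I x (φ (p - p')) = 0 := h2
  rwa [map_sub, map_sub, sub_eq_zero] at h3

theorem value_smul_congr {x : M} {f g : SmoothFun 𝕜 I M} (h : evalAt 𝕜 I x f = evalAt 𝕜 I x g)
    (p : P) : value 𝕜 I (f • p) x = value 𝕜 I (g • p) x := by
  refine (Submodule.Quotient.eq _).2 ?_
  rw [← sub_smul]
  refine Submodule.smul_mem_smul ?_ Submodule.mem_top
  exact RingHom.mem_ker.2 ((map_sub (evalAt 𝕜 I x) _ _).trans (sub_eq_zero.2 h))

theorem value_sum {n : ℕ} (p : Fin n → P) (x : M) :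
    value 𝕜 I (∑ k, p k) x = ∑ k, value 𝕜 I (p k) x :=
  map_sum (Submodule.mkQ (vanishingIdeal 𝕜 I x • ⊤ : Submodule (SmoothFun 𝕜 I M) P)) p _

variable (𝕜 I M P) in
/-- A finite dual basis of a finitely generated projective module. -/
theorem exists_dualBasis [Module.Finite (SmoothFun 𝕜 I M) P]
    [Module.Projective (SmoothFun 𝕜 I M) P] :
    ∃ (n : ℕ) (e : Fin n → P) (φ : Fin n → P →ₗ[SmoothFun 𝕜 I M] SmoothFun 𝕜 I M),
      ∀ p, ∑ k, φ k p • e k = p := by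
  obtain ⟨n, f, g, -, -, hfg⟩ :=
    Module.Finite.exists_comp_eq_id_of_projective (SmoothFun 𝕜 I M) P
  refine ⟨n, fun k => f (Pi.single k 1), fun k => (LinearMap.proj k).comp g, fun p => ?_⟩
  have h := LinearMap.congr_fun hfg p
  conv_rhs => rw [← LinearMap.id_apply (R := SmoothFun 𝕜 I M) p, ← h, LinearMap.comp_apply,
    pi_eq_sum_univ' (g p), map_sum]
  refine Finset.sum_congr rfl fun k _ => ?_
  rw [map_smul]
  rfl

/-- A section of a finitely generated projective module is determined by its values. -/
theorem eq_of_forall_value_eq [Module.Finite (SmoothFun 𝕜 I M) P]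
    [Module.Projective (SmoothFun 𝕜 I M) P] {p p' : P}
    (h : ∀ x : M, value 𝕜 I p x = value 𝕜 I p' x) : p = p' := by
  obtain ⟨n, e, φ, hφ⟩ := exists_dualBasis 𝕜 I M P
  rw [← hφ p, ← hφ p']
  refine Finset.sum_congr rfl fun k _ => ?_
  rw [SmoothFun.ext fun x => evalAt_map_congr (φ k) (h x)]

/-- A family of vectors in the fibres that coincides locally with global sections is the family of
values of a global section. -/
theorem exists_forall_value_eq [Module.Finite (SmoothFun 𝕜 I M) P]
    [Module.Projective (SmoothFun 𝕜 I M) P] (s : ∀ x : M, Fibre 𝕜 I P x)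
    (hs : ∀ x, ∃ p : P, ∀ᶠ y in 𝓝 x, s y = value 𝕜 I p y) :
    ∃ p : P, ∀ x, value 𝕜 I p x = s x := by
  obtain ⟨n, e, φ, hφ⟩ := exists_dualBasis 𝕜 I M P
  choose a ha using fun x => exists_eq_value (s x)
  let f : Fin n → SmoothFun 𝕜 I M := fun k => ⟨fun x => evalAt 𝕜 I x (φ k (a x)), by
    intro x
    obtain ⟨p, hp⟩ := hs x
    have hsm : ContMDiffAt I 𝓘(ℝ, 𝕜) ∞ (φ k p).1 x := (φ k p).2 x
    refine hsm.congr_of_eventuallyEq ?_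
    filter_upwards [hp] with y hy
    exact evalAt_map_congr (φ k) ((ha y).symm.trans hy)⟩
  refine ⟨∑ k, f k • e k, fun x => ?_⟩
  rw [ha x]
  conv_rhs => rw [← hφ (a x)]
  rw [value_sum, value_sum]
  exact Finset.sum_congr rfl fun k _ => 
    value_smul_congr (f := f k) (g := φ k (a x)) (x := x) rfl (e k)

/-- A vector field whose values vanish is zero. -/
theorem vectorField_eq_zero {D : VectorField 𝕜 I M} (h : ∀ x : M, value 𝕜 I D x = 0) : D = 0 := by
  ext1 f
  refine SmoothFun.ext fun x => ?_
  let ev : VectorField 𝕜 I M →ₗ[SmoothFun 𝕜 I M] SmoothFun 𝕜 I M :=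
    { toFun := fun D => D f, map_add' := fun _ _ => rfl, map_smul' := fun _ _ => rfl }
  exact evalAt_map_congr ev (p := D) (p' := 0) (h x)

end Sections

section Gluing

variable {𝕜 : Type*} [RCLike 𝕜] {E : Type*} [NormedAddCommGroup E] [NormedSpace ℝ E]
  {H : Type*} [TopologicalSpace H] {I : ModelWithCorners ℝ E H}
  {M : Type*} [TopologicalSpace M] [ChartedSpace H M]
  {A : Type*} [LieRing A] [LieAlgebra 𝕜 A] [Module (SmoothFun 𝕜 I M) A]
  [LieRingModule A (SmoothFun 𝕜 I M)] [LieRinehartRing (SmoothFun 𝕜 I M) A]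
  [LieRinehartAlgebra 𝕜 (SmoothFun 𝕜 I M) A]

theorem value_smul (f : SmoothFun 𝕜 I M) (a : A) (x : M) :
    value 𝕜 I (f • a) x = evalAt 𝕜 I x f • value 𝕜 I a x := by
  rw [value_smul_congr (g := algebraMap 𝕜 _ (evalAt 𝕜 I x f))
    ((evalAt 𝕜 I x).commutes _).symm, algebraMap_smul]
  rfl

variable (𝕜 I M A) in
/-- The dimensions of the fibres of a Lie algebroid are bounded. -/
theorem exists_finrank_fibre_le [Module.Finite (SmoothFun 𝕜 I M) A]
    [Module.Projective (SmoothFun 𝕜 I M) A] :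
    ∃ n : ℕ, ∀ x : M, Module.Finite 𝕜 (Fibre 𝕜 I A x) ∧
      Module.finrank 𝕜 (Fibre 𝕜 I A x) ≤ n := by
  obtain ⟨n, e, φ, hφ⟩ := exists_dualBasis 𝕜 I M A
  refine ⟨n, fun x => ?_⟩
  have hspan : Submodule.span 𝕜 (Set.range fun k => value 𝕜 I (e k) x) = ⊤ := by
    refine eq_top_iff.2 fun v _ => ?_
    obtain ⟨p, rfl⟩ := exists_eq_value v
    rw [← hφ p, value_sum]
    refine Submodule.sum_mem _ fun k _ => ?_
    rw [value_smul]
    exact Submodule.smul_mem _ _ (Submodule.subset_span ⟨k, rfl⟩)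
  refine ⟨⟨(Submodule.fg_def).2 ⟨_, Set.finite_range _, hspan⟩⟩, ?_⟩
  have h := finrank_range_le_card (R := 𝕜) (fun k => value 𝕜 I (e k) x)
  rwa [Set.finrank, hspan, finrank_top, Fintype.card_fin] at h

theorem alternatingMap_eq_zero_of_finrank_lt {V N : Type*} [AddCommGroup V] [Module 𝕜 V]
    [Module.Finite 𝕜 V] [AddCommGroup N] [Module 𝕜 N] {q : ℕ} (h : Module.finrank 𝕜 V < q)
    (w : V [⋀^Fin q]→ₗ[𝕜] N) : w = 0 := by
  ext v
  refine w.map_linearDependent v fun hv => ?_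
  have := hv.fintype_card_le_finrank
  rw [Fintype.card_fin] at this
  omega

/-- A field of alternating maps on the fibres that sends global sections to families which coincide
locally with global sections is a form. -/
theorem exists_form_formAt_eq [Module.Finite (SmoothFun 𝕜 I M) A]
    [Module.Projective (SmoothFun 𝕜 I M) A] {q : ℕ}
    (η : ∀ x : M, Fibre 𝕜 I A x [⋀^Fin q]→ₗ[𝕜] KernelFibre 𝕜 I A x)
    (hη : ∀ (a : Fin q → A) (x : M), ∃ p : A, ∀ᶠ y in 𝓝 x,
      (η y fun k => value 𝕜 I (a k) y : Fibre 𝕜 I A y) = value 𝕜 I p y) :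
    ∃ W : Form 𝕜 I M A q, ∀ x, formAt W x = η x := by
  choose F hF using fun a => exists_forall_value_eq _ (hη a)
  have hker : ∀ a, F a ∈ Kernel 𝕜 I M A := fun a => by
    refine LinearMap.mem_ker.2 (vectorField_eq_zero fun x => ?_)
    change anchorAt 𝕜 I A x (value 𝕜 I (F a) x) = 0
    rw [hF]
    exact LinearMap.mem_ker.1 (η x _).2
  let W : Form 𝕜 I M A q :=
    { toFun := fun a => ⟨F a, hker a⟩
      map_update_add' := fun a k b c => by
        refine Subtype.ext (eq_of_forall_value_eq (𝕜 := 𝕜) (I := I) (M := M) fun x => ?_)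
        change value 𝕜 I (F _) x = value 𝕜 I (F _) x + value 𝕜 I (F _) x
        rw [hF, hF, hF, ← update_value, ← update_value, ← update_value, ← Submodule.coe_add,
          ← AlternatingMap.map_update_add]
        rfl
      map_update_smul' := fun a k f b => by
        refine Subtype.ext (eq_of_forall_value_eq (𝕜 := 𝕜) (I := I) (M := M) fun x => ?_)
        change value 𝕜 I (F _) x = value 𝕜 I (f • F _) x
        rw [value_smul, hF, hF, ← update_value, ← update_value, value_smul,
          AlternatingMap.map_update_smul]
        rfl
      map_eq_zero_of_eq' := fun a i j h hij => by
        refine Subtype.ext (eq_of_forall_value_eq (𝕜 := 𝕜) (I := I) (M := M) fun x => ?_)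
        change value 𝕜 I (F _) x = 0
        rw [hF, (η x).map_eq_zero_of_eq _ (by rw [h]) hij]
        rfl }
  refine ⟨W, fun x => AlternatingMap.ext fun v => ?_⟩
  obtain ⟨a, rfl⟩ := exists_value_eq v
  exact (formAtFun_value W x a).trans (Subtype.ext (hF a x))

variable {𝔤 : Type*} [LieRing 𝔤] [LieAlgebra 𝕜 𝔤]

/-- The alternating map `Ψ ∘ w ∘ S⁻¹` on the fibre of `A` that is given by a local form. -/
def LocalTrivialization.fibreForm (T : LocalTrivialization 𝕜 I M A 𝔤) {q : ℕ}
    (w : LocalForm 𝕜 I 𝔤 T.U q) (x : T.U) :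
    Fibre 𝕜 I A (x : M) [⋀^Fin q]→ₗ[𝕜] KernelFibre 𝕜 I A (x : M) :=
  (T.Ψ x).toLinearMap.compAlternatingMap ((w.1 x).compLinearMap (T.S x).symm.toLinearMap)

theorem LocalTrivialization.fibreForm_apply (T : LocalTrivialization 𝕜 I M A 𝔤) {q : ℕ}
    (w : LocalForm 𝕜 I 𝔤 T.U q) (x : T.U) (v : Fin q → Fibre 𝕜 I A (x : M)) :
    T.fibreForm w x v = T.Ψ x (w.1 x fun k => (T.S x).symm (v k)) :=
  rfl

variable [FiniteDimensional ℝ E] [IsManifold I ∞ M] [T2Space M]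

theorem LocalTrivialization.isSection_fibreForm (T : LocalTrivialization 𝕜 I M A 𝔤) {q : ℕ}
    (w : LocalForm 𝕜 I 𝔤 T.U q) (a : Fin q → A) :
    IsSection 𝕜 I fun x : T.U =>
      (T.fibreForm w x (fun k => value 𝕜 I (a k) (x : M)) : Fibre 𝕜 I A (x : M)) :=
  T.isSection_Ψ _ (w.2 (fun k x => (T.S x).symm (value 𝕜 I (a k) (x : M))) fun k =>
    T.isTLASection_S_symm le_rfl (isSection_value T.U (a k)))

variable [FiniteDimensional 𝕜 𝔤]

theorem LocalTrivialization.loc_apply (T : LocalTrivialization 𝕜 I M A 𝔤) {q : ℕ}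
    (W : Form 𝕜 I M A q) (x : T.U) (v : Fin q → TLAFibre 𝕜 I 𝔤 (x : M)) :
    (T.loc W).1 x v = (T.Ψ x).symm (formAt W (x : M) fun k => T.S x (v k)) :=
  rfl

theorem LocalTrivialization.loc_eq_of_formAt_eq (T : LocalTrivialization 𝕜 I M A 𝔤) {q : ℕ}
    {W : Form 𝕜 I M A q} {w : LocalForm 𝕜 I 𝔤 T.U q}
    (h : ∀ x : T.U, formAt W (x : M) = T.fibreForm w x) : T.loc W = w := by
  refine Subtype.ext (funext fun x => AlternatingMap.ext fun v => ?_)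
  rw [T.loc_apply, h, T.fibreForm_apply, LinearEquiv.symm_apply_apply]
  simp only [LinearEquiv.symm_apply_apply]

/-- The trivializations of a global form are related by the changes of trivialization. -/
theorem LocalTrivialization.alphaHat_restrict_loc (T T' : LocalTrivialization 𝕜 I M A 𝔤) {q : ℕ}
    (W : Form 𝕜 I M A q) :
    T.alphaHat T' (LocalForm.restrict inf_le_right (T'.loc W))
      = LocalForm.restrict inf_le_left (T.loc W) := by
  refine Subtype.ext (funext fun x => AlternatingMap.ext fun v => ?_)
  change T.alpha T' x ((T'.loc W).1 ⟨x, x.2.2⟩ fun k => T.transition T' x (v k))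
    = (T.loc W).1 ⟨x, x.2.1⟩ v
  rw [loc_apply, loc_apply]
  simp [alpha, transition]

/-- Local forms that are related by the change of trivialization define the same alternating maps on
the fibres of `A`. -/
theorem LocalTrivialization.fibreForm_eq_of_alphaHat_eq (T T' : LocalTrivialization 𝕜 I M A 𝔤)
    {q : ℕ} {w : LocalForm 𝕜 I 𝔤 T.U q} {w' : LocalForm 𝕜 I 𝔤 T'.U q}
    (h : T.alphaHat T' (LocalForm.restrict inf_le_right w') = LocalForm.restrict inf_le_left w)
    {x : M} (hx : x ∈ T.U) (hx' : x ∈ T'.U) :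
    T.fibreForm w ⟨x, hx⟩ = T'.fibreForm w' ⟨x, hx'⟩ := by
  refine AlternatingMap.ext fun v => ?_
  have h1 : T.alpha T' ⟨x, hx, hx'⟩ (w'.1 ⟨x, hx'⟩ fun k =>
      T.transition T' ⟨x, hx, hx'⟩ ((T.S ⟨x, hx⟩).symm (v k)))
      = w.1 ⟨x, hx⟩ fun k => (T.S ⟨x, hx⟩).symm (v k) :=
    DFunLike.congr_fun (congrFun (congrArg Subtype.val h) ⟨x, hx, hx'⟩)
      fun k => (T.S ⟨x, hx⟩).symm (v k)
  rw [fibreForm_apply, fibreForm_apply, ← h1]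
  simp [alpha, transition]

/-- Compatible local forms of degree `q` are the trivializations of a global form. -/
theorem Atlas.exists_loc_eq [Module.Finite (SmoothFun 𝕜 I M) A]
    [Module.Projective (SmoothFun 𝕜 I M) A] {ι : Type*} (𝒜 : Atlas 𝕜 I M A 𝔤 ι) {q : ℕ}
    (w : ∀ i, LocalForm 𝕜 I 𝔤 (𝒜.triv i).U q)
    (h : ∀ i j, (((𝒜.triv i).U ⊓ (𝒜.triv j).U : Opens M) : Set M).Nonempty →
      (𝒜.triv i).alphaHat (𝒜.triv j) (LocalForm.restrict inf_le_right (w j))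
        = LocalForm.restrict inf_le_left (w i)) :
    ∃ W : Form 𝕜 I M A q, ∀ i, (𝒜.triv i).loc W = w i := by
  choose c hc using 𝒜.cover
  have hη : ∀ (i : ι) (x : M) (hx : x ∈ (𝒜.triv i).U),
      (𝒜.triv (c x)).fibreForm (w (c x)) ⟨x, hc x⟩ = (𝒜.triv i).fibreForm (w i) ⟨x, hx⟩ :=
    fun i x hx => (𝒜.triv (c x)).fibreForm_eq_of_alphaHat_eq (𝒜.triv i)
      (h _ _ ⟨x, hc x, hx⟩) (hc x) hx
  obtain ⟨W, hW⟩ := exists_form_formAt_eq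
    (fun x => (𝒜.triv (c x)).fibreForm (w (c x)) ⟨x, hc x⟩) fun a x => by
      obtain ⟨p, hp⟩ := (𝒜.triv (c x)).isSection_fibreForm (w (c x)) a x (hc x)
      refine ⟨p, ?_⟩
      filter_upwards [hp, (𝒜.triv (c x)).U.isOpen.mem_nhds (hc x)] with y hy hyU
      rw [hη (c x) y hyU]
      exact hy hyU
  exact ⟨W, fun i => (𝒜.triv i).loc_eq_of_formAt_eq fun x => (hW x).trans (hη i x x.2)⟩

end Gluing

end TransitiveLieAlgebroid

theorem mainTheorem1 {𝕜 : Type*} [RCLike 𝕜]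
    -- the base manifold
    {E : Type*} [NormedAddCommGroup E] [NormedSpace ℝ E] [FiniteDimensional ℝ E]
    {H : Type*} [TopologicalSpace H] (I : ModelWithCorners ℝ E H) [I.Boundaryless]
    {M : Type*} [TopologicalSpace M] [ChartedSpace H M] [IsManifold I ∞ M]
    [T2Space M] [SigmaCompactSpace M]
    -- the transitive Lie algebroid
    {A : Type*} [LieRing A] [LieAlgebra 𝕜 A] [Module (SmoothFun 𝕜 I M) A]
    [LieRingModule A (SmoothFun 𝕜 I M)] [LieRinehartRing (SmoothFun 𝕜 I M) A]
    [LieRinehartAlgebra 𝕜 (SmoothFun 𝕜 I M) A]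
    [Module.Finite (SmoothFun 𝕜 I M) A] [Module.Projective (SmoothFun 𝕜 I M) A]
    (hA : IsTransitive 𝕜 I M A)
    -- the Lie algebra on which the kernel is modelled, and the atlas
    {𝔤 : Type*} [LieRing 𝔤] [LieAlgebra 𝕜 𝔤] [FiniteDimensional 𝕜 𝔤]
    {ι : Type*} (𝒜 : Atlas 𝕜 I M A 𝔤 ι)
    -- the family of local forms, in the total graded spaces
    (w : ∀ i, DirectSum ℕ fun q => LocalForm 𝕜 I 𝔤 (𝒜.triv i).U q) :
    (∃ W : DirectSum ℕ fun q => Form 𝕜 I M A q,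
      ∀ i q, (𝒜.triv i).loc (W q) = w i q) ↔
    ∀ i j, (((𝒜.triv i).U ⊓ (𝒜.triv j).U : Opens M) : Set M).Nonempty →
      ∀ q, (𝒜.triv i).alphaHat (𝒜.triv j) (LocalForm.restrict inf_le_right (w j q))
        = LocalForm.restrict inf_le_left (w i q) := by
  classical
  constructor
  · rintro ⟨W, hW⟩ i j - q
    rw [← hW i q, ← hW j q]
    exact (𝒜.triv i).alphaHat_restrict_loc (𝒜.triv j) (W q)
  · intro h
    choose W hW using fun q => 𝒜.exists_loc_eq (fun i => w i q) fun i j hij => h i j hij q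
    obtain ⟨n, hn⟩ := exists_finrank_fibre_le 𝕜 I M A
    refine ⟨DirectSum.mk _ (Finset.range (n + 1)) fun q => W q, fun i q => ?_⟩
    by_cases hq : q ∈ Finset.range (n + 1)
    · rw [DirectSum.mk_apply_of_mem hq]
      exact hW q i
    · rw [DirectSum.mk_apply_of_notMem hq]
      refine (𝒜.triv i).loc_eq_of_formAt_eq fun x => ?_
      have := (hn x).1
      have hlt : Module.finrank 𝕜 (Fibre 𝕜 I A (x : M)) < q := by
        have := (hn x).2
        rw [Finset.mem_range] at hq
        omega
      exact (alternatingMap_eq_zero_of_finrank_lt hlt _).trans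
        (alternatingMap_eq_zero_of_finrank_lt hlt _).symm
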